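/- Let $r \ge 2$ be an integer. A digraph is a set of vertices together with a set of ordered pairs of vertices, called arcs; an *oriented graph* is a digraph with no loops and no two opposite arcs $uv, vu$, and it is *$r$-regular* if every vertex has exactly $r$ out-arcs and exactly $r$ in-arcs. For a finite digraph $D$, let $\vec\alpha(D)$ be the maximum size of a set of vertices of $D$ which induces a subdigraph with no directed cycle. Then there exist a constant $c > 0$ and an integer $n_0$, both depending only on $r$, such that for every integer $n \ge n_0$ there is at least one $r$-regular oriented graph with vertex set $\{1,\dots,n\}$ and, if $D$ is chosen uniformly at random among all of them, then $$\mathbb P\left(\vec\alpha(D) \le \tfrac{99}{100}\, n\right) \ge 1 - e^{-cn}.$$ -/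

import Mathlib

open MeasureTheory ProbabilityTheory Filter

namespace Digraph

/-- The subdigraph of `D` induced by a set `S` of vertices. -/
def inducedOn {V : Type*} (D : Digraph V) (S : Set V) : Digraph S where
  Adj u v := D.Adj u v

/-- `D` contains a directed cycle: pairwise distinct vertices `c 0, …, c k` (`k + 1 ≥ 1` of them)
with an arc from each to the next, and from the last back to the first (addition in
`Fin (k + 1)` is cyclic). Loops (`k = 0`) and digons (`k = 1`) are directed cycles. -/
def HasDirectedCycle {V : Type*} (D : Digraph V) : Prop :=
  ∃ (k : ℕ) (c : Fin (k + 1) → V), Function.Injective c ∧ ∀ i, D.Adj (c i) (c (i + 1))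

/-- A set of vertices is acyclic if the subdigraph it induces has no directed cycle. -/
def IsAcyclicSet {V : Type*} (D : Digraph V) (S : Set V) : Prop :=
  ¬ (D.inducedOn S).HasDirectedCycle

open Classical in
/-- The maximum size of an acyclic set of vertices of a finite digraph. -/
noncomputable def acyclicNumber {V : Type*} [Fintype V] (D : Digraph V) : ℕ :=
  (Finset.univ.filter fun S : Finset V => D.IsAcyclicSet (S : Set V)).sup Finset.card

/-- An oriented graph: a digraph with no loops and no digons. (Parallel arcs are
excluded by the type `Digraph`.) -/
def IsOrientedGraph {V : Type*} (D : Digraph V) : Prop :=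
  (∀ v, ¬ D.Adj v v) ∧ ∀ u v, D.Adj u v → ¬ D.Adj v u

/-- Every vertex has exactly `r` out-arcs and exactly `r` in-arcs. (For a digraph without
parallel arcs, on a finite vertex set.) -/
def IsRegularDigraph {V : Type*} (D : Digraph V) (r : ℕ) : Prop :=
  ∀ v, {w | D.Adj v w}.ncard = r ∧ {w | D.Adj w v}.ncard = r

/-- Every set of digraphs is an event. -/
instance instMeasurableSpaceDigraph {V : Type*} : MeasurableSpace (Digraph V) := ⊤

instance instDiscreteMeasurableSpaceDigraph {V : Type*} :
    DiscreteMeasurableSpace (Digraph V) := ⟨fun _ => trivial⟩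

/-- The `r`-regular oriented graphs with vertices labelled by `Fin n`. -/
def regularOrientedGraphs (n r : ℕ) : Set (Digraph (Fin n)) :=
  {D | D.IsOrientedGraph ∧ D.IsRegularDigraph r}

end Digraph

/-- The events `A n`, each in its own space with law `P n`, hold with very high probability:
`P n (A n) = 1 - exp (-Ω(n))` as `n → ∞`. (The `P n` are meant to be probability measures
for all large `n`; if `P n` is the zero measure, the inequality below fails at `n ≥ 1`.) -/
def HoldsWithVeryHighProbability {Ω : ℕ → Type*} [∀ n, MeasurableSpace (Ω n)]
    (P : ∀ n, Measure (Ω n)) (A : ∀ n, Set (Ω n)) : Prop :=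
  ∃ c : ℝ, 0 < c ∧ ∀ᶠ n : ℕ in atTop, 1 - Real.exp (-(c * n)) ≤ (P n).real (A n)

/-!
Generate an `r`-regular digraph by a uniformly random matching of `r` out-stubs to `r` in-stubs per
vertex; every `r`-regular oriented graph arises from the same number of matchings. If `S` is an
acyclic set missing only a small set `T` of vertices, then repeatedly removing a sink of `S` yields
a set `B` of any prescribed size `b` all of whose out-arcs end in `T ∪ B`. For fixed `T` and `B` a
random matching achieves this with probability at most `(|T ∪ B| / n) ^ (b r)`, and for `r ≥ 2`,
`|T| ≈ n / 100` and `b ≈ n / 10` this beats the number of choices of `T` and `B` by an exponential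
factor. The expected number of stubs that obstruct simplicity is at most `6 r ^ 2`, and each of them
can be switched away at the cost of a factor `(n r) ^ 2` in the number of matchings, so a random
matching yields an oriented graph with probability at least `n ^ (-O(1))`; conditioning on this
event preserves the exponential bound.
-/

open Digraph Finset

section UniformOn

variable {Ω β : Type*} [Fintype β]

theorem uniformOn_real_eq_ncard_div_ncard [MeasurableSpace Ω] [MeasurableSingletonClass Ω]
    {s : Set Ω} (hs : s.Finite) (t : Set Ω) :
    (uniformOn s).real t = ((s ∩ t).ncard : ℝ) / s.ncard := by
  rw [uniformOn, Measure.real, cond_apply hs.measurableSet, Measure.count_apply_finite _ hs,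
    Measure.count_apply_finite _ (hs.inter_of_left t), ← Set.ncard_eq_toFinset_card s hs,
    ← Set.ncard_eq_toFinset_card (s ∩ t) (hs.inter_of_left t), ENNReal.toReal_mul,
    ENNReal.toReal_inv, ENNReal.toReal_natCast, ENNReal.toReal_natCast, inv_mul_eq_div]

theorem card_apply_mem_eq_ncard_mul [DecidableEq Ω] {f : β → Ω} {s : Set Ω}
    [DecidablePred (f · ∈ s)] (hs : s.Finite) {k : ℕ} (hf : ∀ ω ∈ s, #{b | f b = ω} = k) :
    #{b | f b ∈ s} = s.ncard * k := by
  obtain ⟨S, rfl⟩ := hs.exists_finset_coe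
  have hmaps : Set.MapsTo f ({b | f b ∈ (S : Set Ω)} : Finset β) S :=
    fun b hb ↦ (mem_filter.mp hb).2
  rw [Set.ncard_coe_finset, card_eq_sum_card_fiberwise hmaps]
  refine sum_const_nat fun ω hω ↦ ?_
  rw [← hf ω hω, filter_filter]
  exact congrArg card (filter_congr fun b _ ↦ and_iff_right_of_imp fun h ↦ h ▸ hω)

theorem uniformOn_real_eq_dens_div_dens [MeasurableSpace Ω] [MeasurableSingletonClass Ω]
    [DecidableEq Ω] {f : β → Ω} {s t : Set Ω} [DecidablePred (f · ∈ s)]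
    [DecidablePred (f · ∈ s ∩ t)] (hs : s.Finite) {k : ℕ} (hk : k ≠ 0)
    (hf : ∀ ω ∈ s, #{b | f b = ω} = k) :
    (uniformOn s).real t = (dens {b | f b ∈ s ∩ t} : ℝ) / dens {b | f b ∈ s} := by
  rcases s.eq_empty_or_nonempty with rfl | ⟨ω, hω⟩
  · simp
  have : Nonempty β := by
    obtain ⟨b, -⟩ := card_ne_zero.mp ((hf ω hω).trans_ne hk)
    exact ⟨b⟩
  rw [uniformOn_real_eq_ncard_div_ncard hs, nnratCast_dens, nnratCast_dens,
    div_div_div_cancel_right₀ (Nat.cast_ne_zero.mpr Fintype.card_ne_zero),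
    card_apply_mem_eq_ncard_mul hs hf,
    card_apply_mem_eq_ncard_mul (hs.inter_of_left t) fun ω hω ↦ hf ω hω.1, Nat.cast_mul,
    Nat.cast_mul, mul_div_mul_right _ _ (Nat.cast_ne_zero.mpr hk)]

end UniformOn

section RandomPermutation

variable {α : Type*} [Fintype α] [DecidableEq α]

theorem card_perm_restrict_eq_le (X : Finset α) (g : X → α) :
    #{π : Equiv.Perm α | X.restrict π = g} ≤ (Fintype.card α - #X).factorial := by
  rcases isEmpty_or_nonempty {π : Equiv.Perm α // X.restrict π = g} with hempty | ⟨π₀, rfl⟩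
  · simp [← Fintype.card_subtype]
  have hcard : Fintype.card {σ : Equiv.Perm α // ∀ a, ¬ a ∉ X → σ a = a} =
      (Fintype.card α - #X).factorial := by
    rw [← Fintype.card_congr (Equiv.Perm.subtypeEquivSubtypePerm (· ∉ X)), Fintype.card_perm,
      Fintype.card_subtype_compl, Fintype.card_coe]
  rw [← hcard, ← Fintype.card_subtype]
  refine Fintype.card_le_of_injective (fun π ↦ ⟨π₀⁻¹ * π.1, fun a ha ↦ ?_⟩)
    fun π π' h ↦ Subtype.ext (mul_left_cancel (congrArg Subtype.val h))
  exact π₀.symm_apply_eq.mpr (congrFun π.2 ⟨a, not_not.mp ha⟩)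

theorem card_perm_mapsTo_le (X Y : Finset α) :
    #{π : Equiv.Perm α | ∀ x ∈ X, π x ∈ Y} ≤
      (Fintype.card α - #X).factorial * (#Y).descFactorial #X := by
  have hemb : #(univ : Finset (X ↪ Y)) = (#Y).descFactorial #X := by simp
  let val (f : X ↪ Y) : X → α := fun x ↦ f x
  calc #{π : Equiv.Perm α | ∀ x ∈ X, π x ∈ Y}
      ≤ (Fintype.card α - #X).factorial * #(univ.image val) := by
        refine card_le_mul_card_image_of_maps_to
          (f := fun π : Equiv.Perm α ↦ X.restrict (π : α → α)) (fun π hπ ↦ ?_)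
          (Fintype.card α - #X).factorial fun g _ ↦ ?_
        · exact mem_image.mpr ⟨⟨fun x ↦ ⟨π x, (mem_filter_univ π).mp hπ x x.2⟩, fun x y hxy ↦
            Subtype.ext (π.injective (congrArg Subtype.val hxy))⟩, mem_univ _, rfl⟩
        · exact (card_le_card (filter_subset_filter _ (subset_univ _))).trans
            (card_perm_restrict_eq_le X g)
    _ ≤ _ := by
        rw [← hemb]
        exact Nat.mul_le_mul_left _ card_image_le

theorem descFactorial_mul_pow_le {k n : ℕ} (h : k ≤ n) (b : ℕ) :
    k.descFactorial b * n ^ b ≤ k ^ b * n.descFactorial b := by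
  induction b with
  | zero => rfl
  | succ b ih =>
    have hfactor : (k - b) * n ≤ k * (n - b) := by
      rw [Nat.sub_mul, Nat.mul_sub, Nat.mul_comm k b]
      exact Nat.sub_le_sub_left (Nat.mul_le_mul_left b h) _
    calc k.descFactorial (b + 1) * n ^ (b + 1)
        = (k - b) * n * (k.descFactorial b * n ^ b) := by
          rw [Nat.descFactorial_succ]; ring
      _ ≤ k * (n - b) * (k ^ b * n.descFactorial b) := Nat.mul_le_mul hfactor ih
      _ = k ^ (b + 1) * n.descFactorial (b + 1) := by
          rw [Nat.descFactorial_succ]; ring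

theorem dens_perm_mapsTo_le (X Y : Finset α) :
    dens {π : Equiv.Perm α | ∀ x ∈ X, π x ∈ Y} ≤ Y.dens ^ #X := by
  rcases isEmpty_or_nonempty α with _ | _
  · simp [Subsingleton.elim X ∅]
  have : (0 : ℚ≥0) < Fintype.card α := by exact_mod_cast Fintype.card_pos
  rw [dens, dens, Fintype.card_perm, div_pow, div_le_div_iff₀ (by positivity) (by positivity)]
  norm_cast
  calc #{π : Equiv.Perm α | ∀ x ∈ X, π x ∈ Y} * Fintype.card α ^ #X
      ≤ (Fintype.card α - #X).factorial * (#Y).descFactorial #X * Fintype.card α ^ #X := by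
        gcongr
        exact card_perm_mapsTo_le X Y
    _ ≤ (Fintype.card α - #X).factorial * (#Y ^ #X * (Fintype.card α).descFactorial #X) := by
        rw [mul_assoc]
        exact Nat.mul_le_mul_left _ (descFactorial_mul_pow_le (card_le_univ Y) _)
    _ = #Y ^ #X * (Fintype.card α).factorial := by
        rw [← Nat.factorial_mul_descFactorial (card_le_univ X), mul_left_comm]

end RandomPermutation

section AcyclicSets

theorem exists_mem_periodicPts {α : Type*} [Finite α] [Nonempty α] (f : α → α) :
    ∃ x, x ∈ Function.periodicPts f := by
  inhabit α
  obtain ⟨a, b, hab, heq⟩ := Finite.exists_ne_map_eq_of_infinite fun k : ℕ ↦ f^[k] default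
  wlog hlt : a < b generalizing a b
  · exact this b a hab.symm heq.symm (hab.lt_or_gt.resolve_left hlt)
  refine ⟨f^[a] default, Function.mk_mem_periodicPts (Nat.sub_pos_of_lt hlt) ?_⟩
  rw [Function.IsPeriodicPt, Function.IsFixedPt, ← Function.iterate_add_apply,
    Nat.sub_add_cancel hlt.le]
  exact heq.symm

theorem hasDirectedCycle_of_forall_exists_adj {V : Type*} [Finite V] [Nonempty V]
    {D : Digraph V} (h : ∀ v, ∃ w, D.Adj v w) : D.HasDirectedCycle := by
  choose next hnext using h
  obtain ⟨x, hx⟩ := exists_mem_periodicPts next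
  obtain ⟨k, hk⟩ := Nat.exists_eq_add_one.mpr (Function.minimalPeriod_pos_of_mem_periodicPts hx)
  refine ⟨k, fun i ↦ next^[i] x, fun i j hij ↦ Fin.ext ?_, fun i ↦ ?_⟩
  · exact Function.iterate_injOn_Iio_minimalPeriod (Set.mem_Iio.mpr (by omega))
      (Set.mem_Iio.mpr (by omega)) hij
  · have hsucc : next^[(i + 1 : Fin (k + 1))] x = next (next^[i] x) := by
      rw [Fin.val_add, Fin.val_one', Nat.add_mod_mod, ← Function.iterate_succ_apply' next,
        ← Function.iterate_mod_minimalPeriod_eq (n := i + 1), hk]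
    change D.Adj _ (next^[(i + 1 : Fin (k + 1))] x)
    rw [hsucc]
    exact hnext _

variable {V : Type*} {D : Digraph V}

theorem isAcyclicSet_mono {S T : Set V} (hT : D.IsAcyclicSet T) (h : S ⊆ T) :
    D.IsAcyclicSet S := fun ⟨k, c, hc, hadj⟩ ↦
  hT ⟨k, Set.inclusion h ∘ c, (Set.inclusion_injective h).comp hc, hadj⟩

theorem exists_sink_of_isAcyclicSet {S : Finset V} (hS : D.IsAcyclicSet (S : Set V))
    (hne : S.Nonempty) : ∃ v ∈ S, ∀ w ∈ S, ¬ D.Adj v w := by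
  by_contra! hadj
  have := hne.to_subtype
  refine hS (hasDirectedCycle_of_forall_exists_adj fun v ↦ ?_)
  obtain ⟨w, hw, hvw⟩ := hadj v v.2
  exact ⟨⟨w, hw⟩, hvw⟩

theorem exists_terminal_subset_of_isAcyclicSet {S : Finset V}
    (hS : D.IsAcyclicSet (S : Set V)) {b : ℕ} (hb : b ≤ #S) :
    ∃ B ⊆ S, #B = b ∧ ∀ v ∈ B, ∀ w ∈ S, D.Adj v w → w ∈ B := by
  classical
  induction b with
  | zero => exact ⟨∅, empty_subset S, rfl, by simp⟩
  | succ b ih =>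
    obtain ⟨B, hBS, hBcard, hB⟩ := ih (by omega)
    obtain ⟨v, hv, hsink⟩ := exists_sink_of_isAcyclicSet
      (isAcyclicSet_mono hS (coe_subset.mpr (sdiff_subset (t := B))))
      (sdiff_nonempty_of_card_lt_card (hBcard.trans_lt hb))
    obtain ⟨hvS, hvB⟩ := mem_sdiff.mp hv
    refine ⟨insert v B, insert_subset hvS hBS, by rw [card_insert_of_notMem hvB, hBcard],
      fun u hu w hw huw ↦ mem_insert_of_mem ?_⟩
    obtain rfl | hu := mem_insert.mp hu
    · by_contra hwB
      exact hsink w (mem_sdiff.mpr ⟨hw, hwB⟩) huw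
    · exact hB u hu w hw huw

theorem exists_isAcyclicSet_card_eq [Fintype V] {m : ℕ} (h : m ≤ D.acyclicNumber) :
    ∃ S : Finset V, #S = m ∧ D.IsAcyclicSet (S : Set V) := by
  classical
  have hempty : D.IsAcyclicSet ((∅ : Finset V) : Set V) :=
    fun ⟨_, c, _⟩ ↦ notMem_empty _ (c 0).2
  obtain ⟨T, hT, hcard⟩ := exists_mem_eq_sup {T : Finset V | D.IsAcyclicSet (T : Set V)}
    ⟨∅, (mem_filter_univ _).mpr hempty⟩ card
  obtain ⟨S, hST, hS⟩ := exists_subset_card_eq (s := T) (h.trans_eq hcard)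
  exact ⟨S, hS, isAcyclicSet_mono (mem_filter.mp hT).2 (coe_subset.mpr hST)⟩

theorem exists_closed_of_le_acyclicNumber_add [Fintype V] [DecidableEq V] {t b : ℕ}
    (htb : t + b ≤ Fintype.card V) (h : Fintype.card V ≤ D.acyclicNumber + t) :
    ∃ T B : Finset V, #T = t ∧ #B = b ∧ ∀ v ∈ B, ∀ w, D.Adj v w → w ∈ T ∪ B := by
  obtain ⟨S, hScard, hS⟩ := exists_isAcyclicSet_card_eq (Nat.sub_le_iff_le_add.mpr h)
  obtain ⟨B, -, hBcard, hB⟩ := exists_terminal_subset_of_isAcyclicSet (b := b) hS (by omega)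
  refine ⟨Sᶜ, B, by rw [card_compl]; omega, hBcard, fun v hv w hvw ↦ mem_union.mpr ?_⟩
  by_cases hw : w ∈ S
  · exact .inr (hB v hv w hw hvw)
  · exact .inl (mem_compl.mpr hw)

end AcyclicSets

/-- The configuration model of `r`-regular digraphs on `V`: every vertex `v` carries `r` out-stubs
and `r` in-stubs, both labelled `(v, 0), …, (v, r - 1)`, and a stub matching joins each out-stub
`x` to the in-stub `π x`. -/
abbrev StubMatching (V : Type*) (r : ℕ) := Equiv.Perm (V × Fin r)

namespace StubMatching

variable {V : Type*} {r : ℕ}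

/-- The digraph of a stub matching, obtained by forgetting the stubs; the multiplicity of parallel
arcs is lost. -/
def toDigraph (π : StubMatching V r) : Digraph V where
  Adj u v := ∃ i, (π (u, i)).1 = v

theorem toDigraph_adj_apply (π : StubMatching V r) (x : V × Fin r) :
    π.toDigraph.Adj x.1 (π x).1 := ⟨x.2, rfl⟩

theorem toDigraph_adj_iff_exists_symm {π : StubMatching V r} {u v : V} :
    π.toDigraph.Adj u v ↔ ∃ j, (π.symm (v, j)).1 = u := by
  constructor
  · rintro ⟨i, rfl⟩
    exact ⟨(π (u, i)).2, by simp⟩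
  · rintro ⟨j, rfl⟩
    exact ⟨(π.symm (v, j)).2, by simp⟩

section Fibres

/-- A surjective labelling by `Fin r` of a set of size `r`, as an equivalence. -/
noncomputable def labellingEquiv {p : V → Prop} (hp : {w | p w}.ncard = r) [Finite V]
    (g : Fin r → V) (hg : ∀ w, p w ↔ ∃ i, g i = w) : Fin r ≃ {w // p w} :=
  Equiv.ofBijective (fun i ↦ ⟨g i, (hg _).mpr ⟨i, rfl⟩⟩) <|
    Function.Surjective.bijective_of_nat_card_le
      (fun w ↦ ((hg w).mp w.2).imp fun _ hi ↦ Subtype.ext hi)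
      ((Nat.card_fin r).trans hp.symm).le

/-- The pairs of the relation `p`, parametrised by stubs: the stub `(u, i)` stands for the pair of
`u` and the `i`-th element related to `u`. -/
def stubEquivSigma {p : V → V → Prop} (L : ∀ u, Fin r ≃ {w // p u w}) :
    V × Fin r ≃ Σ u, {w // p u w} :=
  (Equiv.sigmaEquivProd V (Fin r)).symm.trans (Equiv.sigmaCongrRight L)

/-- The arcs of `D`, grouped by their tails or by their heads. -/
def arcEquiv (D : Digraph V) : (Σ u, {v // D.Adj u v}) ≃ Σ v, {u // D.Adj u v} where
  toFun a := ⟨a.2, a.1, a.2.2⟩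
  invFun a := ⟨a.2, a.1, a.2.2⟩

/-- A stub matching with `r`-regular digraph `D` amounts to a labelling of the out-neighbours and
of the in-neighbours of every vertex. -/
noncomputable def fibreEquiv [Finite V] {D : Digraph V} (hD : D.IsRegularDigraph r) :
    {π : StubMatching V r // π.toDigraph = D} ≃
      (∀ u, Fin r ≃ {v // D.Adj u v}) × (∀ v, Fin r ≃ {u // D.Adj u v}) where
  toFun π :=
    have adj_iff (u v : V) : D.Adj u v ↔ π.1.toDigraph.Adj u v :=
      iff_of_eq (congrArg (Digraph.Adj · u v) π.2.symm)
    (fun u ↦ labellingEquiv (hD u).1 (fun i ↦ (π.1 (u, i)).1) (adj_iff u),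
      fun v ↦ labellingEquiv (hD v).2 (fun j ↦ (π.1.symm (v, j)).1) fun u ↦
        (adj_iff u v).trans toDigraph_adj_iff_exists_symm)
  invFun L :=
    ⟨(stubEquivSigma L.1).trans ((arcEquiv D).trans (stubEquivSigma L.2).symm), by
      ext u v
      exact ⟨fun ⟨i, hi⟩ ↦ hi ▸ (L.1 u i).2,
        fun h ↦ ⟨(L.1 u).symm ⟨v, h⟩, congrArg Subtype.val ((L.1 u).apply_symm_apply ⟨v, h⟩)⟩⟩⟩
  left_inv π := by
    refine Subtype.ext (Equiv.ext fun x ↦ ?_)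
    change (stubEquivSigma _).symm (arcEquiv D (stubEquivSigma _ x)) = π.1 x
    refine (Equiv.symm_apply_eq _).mpr (Sigma.subtype_ext rfl ?_)
    exact congrArg Prod.fst (π.1.symm_apply_apply x).symm
  right_inv _ := Prod.ext (funext fun _ ↦ Equiv.ext fun _ ↦ rfl)
    (funext fun _ ↦ Equiv.ext fun _ ↦ rfl)

theorem card_fin_equiv_subtype [Finite V] {p : V → Prop} (hp : {w | p w}.ncard = r) :
    Nat.card (Fin r ≃ {w // p w}) = r.factorial := by
  have e : {w // p w} ≃ Fin r := Finite.equivFinOfCardEq hp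
  rw [Nat.card_congr ((Equiv.refl _).equivCongr e), Nat.card_perm, Nat.card_fin]

open Classical in
theorem card_toDigraph_eq [Fintype V] [DecidableEq V] {D : Digraph V} (hD : D.IsRegularDigraph r) :
    #{π : StubMatching V r | π.toDigraph = D} = (r.factorial ^ Fintype.card V) ^ 2 := by
  rw [← Fintype.card_subtype, ← Nat.card_eq_fintype_card, Nat.card_congr (fibreEquiv hD),
    Nat.card_prod, Nat.card_pi, Nat.card_pi, sq]
  simp only [card_fin_equiv_subtype (hD _).1, card_fin_equiv_subtype (hD _).2, prod_const,
    card_univ]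

end Fibres

section BadStubs

/-- The undirected edge underlying the arc at the out-stub `x`. -/
def edge (π : StubMatching V r) (x : V × Fin r) : Sym2 V := s(x.1, (π x).1)

/-- The obstruction to `π.toDigraph` being an `r`-regular oriented graph: the arc at the
out-stub `x` is a loop, or parallel or opposite to another arc. -/
def IsBadStub (π : StubMatching V r) (x : V × Fin r) : Prop :=
  (π.edge x).IsDiag ∨ ∃ y ≠ x, π.edge y = π.edge x

theorem eq_of_edge_eq {π : StubMatching V r} {x y : V × Fin r} (hx : ¬ π.IsBadStub x)
    (h : π.edge y = π.edge x) : y = x :=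
  by_contra fun hne ↦ hx (.inr ⟨y, hne, h⟩)

theorem isOrientedGraph_toDigraph {π : StubMatching V r} (h : ∀ x, ¬ π.IsBadStub x) :
    π.toDigraph.IsOrientedGraph := by
  have loopless (v : V) : ¬ π.toDigraph.Adj v v := fun ⟨i, hi⟩ ↦ h (v, i) (.inl hi.symm)
  refine ⟨loopless, fun u v huv hvu ↦ ?_⟩
  obtain ⟨i, hi⟩ := huv
  obtain ⟨j, hj⟩ := hvu
  have hstub : (u, i) = (v, j) := eq_of_edge_eq (h (v, j)) (Sym2.eq_iff.mpr (.inr ⟨hj.symm, hi⟩))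
  obtain rfl : u = v := congrArg Prod.fst hstub
  exact loopless u ⟨i, hi⟩

theorem isRegularDigraph_toDigraph {π : StubMatching V r} (h : ∀ x, ¬ π.IsBadStub x) :
    π.toDigraph.IsRegularDigraph r := by
  intro v
  constructor
  · have hinj : Function.Injective fun i ↦ (π (v, i)).1 := fun i j hij ↦
      congrArg Prod.snd <| eq_of_edge_eq (x := (v, j)) (y := (v, i)) (h (v, j))
        (Sym2.eq_iff.mpr (.inl ⟨rfl, hij⟩))
    exact (Set.ncard_range_of_injective hinj).trans (Nat.card_fin r)
  · have hinj : Function.Injective fun j ↦ (π.symm (v, j)).1 := fun i j hij ↦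
      congrArg Prod.snd <| π.symm.injective <| eq_of_edge_eq (h (π.symm (v, j)))
        (Sym2.eq_iff.mpr (.inl ⟨hij, by simp only [Equiv.apply_symm_apply]⟩))
    have hrange : {u | π.toDigraph.Adj u v} = Set.range fun j ↦ (π.symm (v, j)).1 :=
      Set.ext fun u ↦ toDigraph_adj_iff_exists_symm
    rw [hrange, Set.ncard_range_of_injective hinj, Nat.card_fin]

variable [Fintype V]

open Classical in
/-- The set of bad stubs of `π`, empty if and only if `π` has no loops and no parallel or opposite
arcs. -/
noncomputable def badStubs (π : StubMatching V r) : Finset (V × Fin r) :=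
  {x | π.IsBadStub x}

theorem mem_badStubs {π : StubMatching V r} {x : V × Fin r} :
    x ∈ π.badStubs ↔ π.IsBadStub x := by
  simp only [badStubs, mem_filter_univ]

end BadStubs

section Switching

theorem notMem_and_isBadStub_of_edge_fresh {π π' : StubMatching V r} {T : Set (V × Fin r)}
    (hsame : ∀ w ∉ T, π'.edge w = π.edge w) (hinj : T.InjOn π'.edge)
    (hdiag : ∀ x ∈ T, ¬ (π'.edge x).IsDiag) (hfresh : ∀ x ∈ T, ∀ w, π.edge w ≠ π'.edge x)
    {z : V × Fin r} (hz : π'.IsBadStub z) : z ∉ T ∧ π.IsBadStub z := by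
  have hunique {x w : V × Fin r} (hx : x ∈ T) (hne : w ≠ x) : π'.edge w ≠ π'.edge x := by
    by_cases hw : w ∈ T
    · exact fun h ↦ hne (hinj hw hx h)
    · rw [hsame w hw]
      exact hfresh x hx w
  have hzT : z ∉ T := fun hzT ↦ hz.elim (hdiag z hzT) fun ⟨_, hne, h⟩ ↦ hunique hzT hne h
  refine ⟨hzT, ?_⟩
  rw [IsBadStub, ← hsame z hzT]
  refine hz.imp_right fun ⟨w, hne, h⟩ ↦ ⟨w, hne, ?_⟩
  rw [← hsame w fun hwT ↦ hunique hwT hne.symm h.symm, h]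

variable [DecidableEq V]

/-- The vertices equal or adjacent to `u`, in either direction. -/
def closedNbhd (π : StubMatching V r) (u : V) : Finset V :=
  insert u (univ.image (fun i ↦ (π (u, i)).1) ∪ univ.image fun i ↦ (π.symm (u, i)).1)

theorem card_closedNbhd_le (π : StubMatching V r) (u : V) : #(π.closedNbhd u) ≤ 2 * r + 1 := by
  have himage (f : Fin r → V) : #(univ.image f) ≤ r := card_image_le.trans_eq (card_fin r)
  refine (card_insert_le _ _).trans (Nat.add_le_add_right ((card_union_le _ _).trans ?_) 1)
  rw [two_mul]
  exact Nat.add_le_add (himage _) (himage _)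

theorem self_mem_closedNbhd (π : StubMatching V r) (u : V) : u ∈ π.closedNbhd u :=
  mem_insert_self u _

theorem mem_closedNbhd_of_edge_eq {π : StubMatching V r} {x : V × Fin r} {u v : V}
    (h : π.edge x = s(u, v)) : v ∈ π.closedNbhd u := by
  refine mem_insert_of_mem (mem_union.mpr ?_)
  obtain ⟨rfl, rfl⟩ | ⟨rfl, rfl⟩ := Sym2.eq_iff.mp h
  · exact .inl (mem_image_of_mem _ (mem_univ x.2))
  · refine .inr (mem_image.mpr ⟨(π x).2, mem_univ _, ?_⟩)
    rw [Prod.mk.eta, Equiv.symm_apply_apply]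

/- `π * Equiv.swap x y` exchanges the heads of the arcs at `x` and `y`. Since the arc at `y` is far
from the arc at `x`, neither of the two new edges is a loop or was present before. -/
theorem ne_and_isBadStub_of_isBadStub_mul_swap {π : StubMatching V r} {x y : V × Fin r}
    (hy : ¬ π.IsBadStub y) (hπy : (π y).1 ∉ π.closedNbhd x.1)
    (hyx : y.1 ∉ π.closedNbhd (π x).1) {z : V × Fin r}
    (hz : IsBadStub (π * Equiv.swap x y) z) : z ≠ x ∧ π.IsBadStub z := by
  set π' : StubMatching V r := π * Equiv.swap x y
  have hne : x ≠ y := by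
    rintro rfl
    exact hπy (mem_closedNbhd_of_edge_eq (x := x) rfl)
  have hedge_x : π'.edge x = s(x.1, (π y).1) := by simp [π', edge]
  have hedge_y : π'.edge y = s((π x).1, y.1) := by simp [π', edge, Sym2.eq_swap]
  have hinj : Set.InjOn π'.edge {x, y} := by
    rw [Set.injOn_pair, hedge_x, hedge_y, Sym2.eq_iff]
    rintro (⟨-, hloop⟩ | ⟨htail, hhead⟩)
    · exact absurd (.inl hloop.symm) hy
    · exact eq_of_edge_eq hy (Sym2.eq_iff.mpr (.inl ⟨htail, hhead.symm⟩))
  have hsame (w : V × Fin r) (hw : w ∉ ({x, y} : Set (V × Fin r))) : π'.edge w = π.edge w := by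
    simp only [Set.mem_insert_iff, Set.mem_singleton_iff, not_or] at hw
    simp [π', edge, Equiv.swap_apply_of_ne_of_ne hw.1 hw.2]
  have hdiag : ∀ w ∈ ({x, y} : Set (V × Fin r)), ¬ (π'.edge w).IsDiag := by
    rintro w (rfl | rfl)
    · rw [hedge_x]
      exact fun h ↦ hπy (h ▸ self_mem_closedNbhd π _)
    · rw [hedge_y]
      exact fun h ↦ hyx (h ▸ self_mem_closedNbhd π _)
  have hfresh : ∀ a ∈ ({x, y} : Set (V × Fin r)), ∀ w, π.edge w ≠ π'.edge a := by
    rintro a (rfl | rfl) w h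
    · exact hπy (mem_closedNbhd_of_edge_eq (h.trans hedge_x))
    · exact hyx (mem_closedNbhd_of_edge_eq (h.trans hedge_y))
  exact (notMem_and_isBadStub_of_edge_fresh hsame hinj hdiag hfresh hz).imp_left
    fun hzT h ↦ hzT (.inl h)

variable [Fintype V]

theorem exists_not_isBadStub_notMem_closedNbhd {π : StubMatching V r} (u v : V)
    (h : #π.badStubs + 2 * ((2 * r + 1) * r) < Fintype.card V * r) :
    ∃ y, ¬ π.IsBadStub y ∧ (π y).1 ∉ π.closedNbhd u ∧ y.1 ∉ π.closedNbhd v := by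
  let stubsAt (w : V) : Finset (V × Fin r) := π.closedNbhd w ×ˢ univ
  have hstubsAt (w : V) : #(stubsAt w) ≤ (2 * r + 1) * r := by
    rw [card_product, card_fin]
    exact Nat.mul_le_mul_right r (card_closedNbhd_le π w)
  have hcard : #(π.badStubs ∪ ((stubsAt u).image π.symm ∪ stubsAt v)) <
      #(univ : Finset (V × Fin r)) := by
    have h₁ := card_union_le π.badStubs ((stubsAt u).image π.symm ∪ stubsAt v)
    have h₂ := card_union_le ((stubsAt u).image π.symm) (stubsAt v)
    have h₃ := (card_image_le (f := π.symm)).trans (hstubsAt u)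
    have h₄ := hstubsAt v
    rw [card_univ, Fintype.card_prod, Fintype.card_fin]
    omega
  obtain ⟨y, -, hy⟩ := exists_mem_notMem_of_card_lt_card hcard
  simp only [mem_union, not_or, mem_badStubs] at hy
  refine ⟨y, hy.1, fun hu ↦ hy.2.1 ?_, fun hv ↦ hy.2.2 (mk_mem_product hv (mem_univ _))⟩
  exact mem_image.mpr ⟨π y, mk_mem_product hu (mem_univ _), π.symm_apply_apply y⟩

theorem exists_card_badStubs_mul_swap_lt {π : StubMatching V r} {x : V × Fin r}
    (hx : π.IsBadStub x) (h : #π.badStubs + 2 * ((2 * r + 1) * r) < Fintype.card V * r) :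
    ∃ y, #(badStubs (π * Equiv.swap x y)) < #π.badStubs := by
  obtain ⟨y, hy, hπy, hyx⟩ := exists_not_isBadStub_notMem_closedNbhd x.1 (π x).1 h
  have himp {z : V × Fin r} (hz : z ∈ badStubs (π * Equiv.swap x y)) : z ≠ x ∧ π.IsBadStub z :=
    ne_and_isBadStub_of_isBadStub_mul_swap hy hπy hyx (mem_badStubs.mp hz)
  exact ⟨y, card_lt_card (ssubset_iff_of_subset (fun z hz ↦ mem_badStubs.mpr (himp hz).2) |>.mpr
    ⟨x, mem_badStubs.mpr hx, fun hx' ↦ (himp hx').1 rfl⟩)⟩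

theorem card_filter_card_badStubs_le_succ {b : ℕ}
    (h : b + 1 + 2 * ((2 * r + 1) * r) < Fintype.card V * r) :
    #{π : StubMatching V r | #π.badStubs ≤ b + 1} ≤
      (Fintype.card V * r) ^ 2 * #{π : StubMatching V r | #π.badStubs ≤ b} := by
  have hsub : ({π | #π.badStubs ≤ b + 1} : Finset (StubMatching V r)) ⊆
      (univ : Finset ((V × Fin r) × V × Fin r)).biUnion fun p ↦
        ({π | #π.badStubs ≤ b} : Finset (StubMatching V r)).image (· * Equiv.swap p.1 p.2) := by
    intro π hπ
    rw [mem_filter_univ] at hπ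
    suffices ∃ x y, #(badStubs (π * Equiv.swap x y)) ≤ b by
      obtain ⟨x, y, hxy⟩ := this
      exact mem_biUnion.mpr ⟨(x, y), mem_univ _, mem_image.mpr
        ⟨π * Equiv.swap x y, (mem_filter_univ _).mpr hxy, Equiv.mul_swap_mul_self x y π⟩⟩
    rcases hπ.lt_or_eq with hlt | heq
    · obtain ⟨x⟩ : Nonempty (V × Fin r) := by
        rw [← Fintype.card_pos_iff, Fintype.card_prod, Fintype.card_fin]
        omega
      exact ⟨x, x, by simpa [← Equiv.Perm.one_def] using Nat.le_of_lt_succ hlt⟩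
    · obtain ⟨x, hx⟩ : π.badStubs.Nonempty := card_pos.mp (by omega)
      obtain ⟨y, hy⟩ := exists_card_badStubs_mul_swap_lt (mem_badStubs.mp hx) (by omega)
      exact ⟨x, y, by omega⟩
  refine (card_le_card hsub).trans ((card_biUnion_le_card_mul _ _ _ fun _ _ ↦
    card_image_le).trans_eq ?_)
  simp [sq]

theorem card_filter_card_badStubs_le {b : ℕ}
    (h : b + 2 * ((2 * r + 1) * r) < Fintype.card V * r) :
    #{π : StubMatching V r | #π.badStubs ≤ b} ≤
      (Fintype.card V * r) ^ (2 * b) * #{π : StubMatching V r | π.badStubs = ∅} := by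
  induction b with
  | zero => simp
  | succ b ih =>
    rw [mul_add_one, pow_add, mul_comm (_ ^ (2 * b)), mul_assoc]
    exact (card_filter_card_badStubs_le_succ h).trans (Nat.mul_le_mul_left _ (ih (by omega)))

end Switching

section Densities

variable [Fintype V] [DecidableEq V]

theorem dens_mapsTo_le (X : Finset (V × Fin r)) (W : Finset V) :
    dens {π : StubMatching V r | ∀ x ∈ X, (π x).1 ∈ W} ≤ W.dens ^ #X := by
  rcases X.eq_empty_or_nonempty with rfl | ⟨x, -⟩
  · simp
  have hr : (r : ℚ≥0) ≠ 0 := Nat.cast_ne_zero.mpr x.2.pos.ne'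
  have hdens : (W ×ˢ (univ : Finset (Fin r))).dens = W.dens := by
    rw [dens, dens, card_product, Fintype.card_prod, card_univ, Fintype.card_fin, Nat.cast_mul,
      Nat.cast_mul, mul_div_mul_right _ _ hr]
  simpa [hdens] using dens_perm_mapsTo_le X (W ×ˢ (univ : Finset (Fin r)))

theorem dens_isDiag_edge_le (x : V × Fin r) :
    dens {π : StubMatching V r | (π.edge x).IsDiag} ≤ (Fintype.card V : ℚ≥0)⁻¹ := by
  refine (dens_le_dens fun π hπ ↦ ?_).trans ((dens_mapsTo_le {x} {x.1}).trans_eq (by simp))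
  simpa [edge, eq_comm] using hπ

theorem dens_edge_eq_edge_le_of_fst_eq {x y : V × Fin r} (hne : y ≠ x) (h : y.1 = x.1) :
    dens {π : StubMatching V r | π.edge y = π.edge x} ≤ (Fintype.card V : ℚ≥0)⁻¹ := by
  have hsub : ({π | π.edge y = π.edge x} : Finset (StubMatching V r)) ⊆
      univ.biUnion fun v ↦ {π | ∀ z ∈ ({x, y} : Finset _), (π z).1 ∈ ({v} : Finset V)} := by
    intro π hπ
    rw [mem_filter_univ, edge, edge, h] at hπ
    simp [Sym2.congr_right.mp hπ]
  have : (Fintype.card V : ℚ≥0) ≠ 0 :=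
    Nat.cast_ne_zero.mpr ((Fintype.card_pos_iff.mpr ⟨x.1⟩).ne')
  calc dens {π : StubMatching V r | π.edge y = π.edge x}
      ≤ ∑ v : V, ({v} : Finset V).dens ^ #{x, y} :=
        (dens_le_dens hsub).trans (dens_biUnion_le.trans (sum_le_sum fun v _ ↦ dens_mapsTo_le _ _))
    _ = (Fintype.card V : ℚ≥0)⁻¹ := by
        simp [card_pair hne.symm, sq, this]

theorem dens_edge_eq_edge_le_of_fst_ne {x y : V × Fin r} (h : y.1 ≠ x.1) :
    dens {π : StubMatching V r | π.edge y = π.edge x} ≤ (2 / Fintype.card V) ^ 2 := by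
  have hne : y ≠ x := fun hyx ↦ h (congrArg Prod.fst hyx)
  have hdens : ({x.1, y.1} : Finset V).dens = 2 / Fintype.card V := by
    rw [dens, card_pair h.symm, Nat.cast_two]
  refine (dens_le_dens fun π hπ ↦ ?_).trans ((dens_mapsTo_le {x, y} {x.1, y.1}).trans_eq ?_)
  · obtain ⟨htail, -⟩ | ⟨htail, hhead⟩ := Sym2.eq_iff.mp ((mem_filter_univ π).mp hπ)
    · exact absurd htail h
    · simp [htail, hhead]
  · rw [card_pair hne.symm, hdens]

open Classical in
theorem dens_isBadStub_le (x : V × Fin r) :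
    dens {π : StubMatching V r | π.IsBadStub x} ≤ 6 * r / Fintype.card V := by
  set n : ℚ≥0 := (Fintype.card V : ℚ≥0)
  have hn : n ≠ 0 := Nat.cast_ne_zero.mpr (Fintype.card_pos_iff.mpr ⟨x.1⟩).ne'
  have hr : 1 ≤ (r : ℚ≥0) := Nat.one_le_cast.mpr x.2.pos
  have hedge (y : V × Fin r) (hy : y ∈ univ.erase x) :
      dens {π : StubMatching V r | π.edge y = π.edge x} ≤
        (if y.1 = x.1 then n⁻¹ else 0) + (2 / n) ^ 2 := by
    split_ifs with h
    · exact (dens_edge_eq_edge_le_of_fst_eq (ne_of_mem_erase hy) h).trans le_self_add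
    · exact (dens_edge_eq_edge_le_of_fst_ne h).trans le_add_self
  have hsub : ({π | π.IsBadStub x} : Finset (StubMatching V r)) ⊆
      ({π | (π.edge x).IsDiag} : Finset (StubMatching V r)) ∪
        (univ.erase x).biUnion fun y ↦ {π | π.edge y = π.edge x} := by
    intro π hπ
    simpa [IsBadStub] using hπ
  calc dens {π : StubMatching V r | π.IsBadStub x}
      ≤ n⁻¹ + ∑ y ∈ univ.erase x, ((if y.1 = x.1 then n⁻¹ else 0) + (2 / n) ^ 2) :=
        (dens_le_dens hsub).trans <| (dens_union_le _ _).trans <|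
          add_le_add (dens_isDiag_edge_le x) (dens_biUnion_le.trans (sum_le_sum hedge))
    _ ≤ n⁻¹ + ∑ y : V × Fin r, ((if y.1 = x.1 then n⁻¹ else 0) + (2 / n) ^ 2) := by
        gcongr
        exact subset_univ _
    _ = (1 + 5 * r) / n := by
        have hsum : ∑ y : V × Fin r, (if y.1 = x.1 then n⁻¹ else 0) = r * n⁻¹ := by
          simp [Fintype.sum_prod_type_right]
        rw [sum_add_distrib, hsum, sum_const, card_univ, Fintype.card_prod, Fintype.card_fin,
          nsmul_eq_mul, Nat.cast_mul, show (Fintype.card V : ℚ≥0) = n from rfl]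
        field_simp
        ring
    _ ≤ (r + 5 * r) / n := by gcongr
    _ = 6 * r / n := by ring

theorem dens_lt_card_badStubs_le (hr : r ≠ 0) :
    dens {π : StubMatching V r | 12 * r ^ 2 < #π.badStubs} ≤ 1 / 2 := by
  classical
  have hcard : (0 : ℚ≥0) < Fintype.card (StubMatching V r) := Nat.cast_pos.mpr Fintype.card_pos
  have hmarkov : #{π : StubMatching V r | 12 * r ^ 2 < #π.badStubs} • (12 * r ^ 2 : ℚ≥0) ≤
      #(univ : Finset (V × Fin r)) •
        (6 * r / Fintype.card V * Fintype.card (StubMatching V r) : ℚ≥0) := by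
    refine card_nsmul_le_card_nsmul (fun π x ↦ π.IsBadStub x) (fun π hπ ↦ ?_) fun x _ ↦ ?_
    · exact_mod_cast ((mem_filter_univ π).mp hπ).le
    · rw [← div_le_iff₀ hcard]
      refine le_trans (dens_le_dens ?_) (dens_isBadStub_le x)
      exact filter_subset_filter _ (subset_univ _)
  rw [dens, div_le_iff₀ hcard]
  refine le_of_mul_le_mul_right (a := (12 * r ^ 2 : ℚ≥0)) ?_ (by positivity)
  rw [nsmul_eq_mul, nsmul_eq_mul, card_univ, Fintype.card_prod, Fintype.card_fin,
    Nat.cast_mul] at hmarkov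
  refine hmarkov.trans ?_
  rcases eq_or_ne (Fintype.card V : ℚ≥0) 0 with hn | hn
  · simp [hn]
  · refine le_of_eq ?_
    field_simp
    norm_num

theorem one_le_mul_dens_badStubs_eq_empty (hr : r ≠ 0) (h : 16 * r + 2 < Fintype.card V) :
    1 ≤ 2 * ((Fintype.card V : ℚ≥0) * r) ^ (24 * r ^ 2) *
      dens {π : StubMatching V r | π.badStubs = ∅} := by
  have hgood : 1 / 2 ≤ dens {π : StubMatching V r | #π.badStubs ≤ 12 * r ^ 2} := by
    have hsplit := dens_filter_add_dens_filter_not_eq_dens (s := univ)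
      fun π : StubMatching V r ↦ #π.badStubs ≤ 12 * r ^ 2
    simp only [not_le, dens_univ] at hsplit
    by_contra! hlt
    have hlt_one := add_lt_add_of_lt_of_le hlt (dens_lt_card_badStubs_le (V := V) hr)
    rw [hsplit] at hlt_one
    norm_num at hlt_one
  have hswitch : (dens {π : StubMatching V r | #π.badStubs ≤ 12 * r ^ 2} : ℚ≥0) ≤
      (Fintype.card V * r) ^ (24 * r ^ 2) * dens {π : StubMatching V r | π.badStubs = ∅} := by
    have hcard := card_filter_card_badStubs_le (V := V) (r := r) (b := 12 * r ^ 2)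
      (by nlinarith [Nat.pos_of_ne_zero hr])
    rw [dens, dens, ← mul_div_assoc, show 24 * r ^ 2 = 2 * (12 * r ^ 2) by ring]
    gcongr
    exact_mod_cast hcard
  calc (1 : ℚ≥0) = 2 * (1 / 2) := by norm_num
    _ ≤ _ := by
      rw [mul_assoc]
      exact mul_le_mul_right (hgood.trans hswitch) 2

theorem dens_le_acyclicNumber_add_le {t b : ℕ} (h : t + b ≤ Fintype.card V) :
    dens {π : StubMatching V r | Fintype.card V ≤ π.toDigraph.acyclicNumber + t} ≤
      (Fintype.card V).choose t * (Fintype.card V).choose b *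
        (((t + b : ℕ) : ℚ≥0) / Fintype.card V) ^ (b * r) := by
  have hsub : ({π | Fintype.card V ≤ π.toDigraph.acyclicNumber + t} :
      Finset (StubMatching V r)) ⊆
      (powersetCard t univ ×ˢ powersetCard b (univ : Finset V)).biUnion fun p ↦
        {π | ∀ x ∈ p.2 ×ˢ univ, (π x).1 ∈ p.1 ∪ p.2} := by
    intro π hπ
    obtain ⟨T, B, hT, hB, hTB⟩ :=
      exists_closed_of_le_acyclicNumber_add h ((mem_filter_univ π).mp hπ)
    refine mem_biUnion.mpr ⟨(T, B), ?_, (mem_filter_univ π).mpr fun x hx ↦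
      hTB x.1 (mem_product.mp hx).1 _ (π.toDigraph_adj_apply x)⟩
    simp [hT, hB]
  refine (dens_le_dens hsub).trans <| dens_biUnion_le.trans <|
    (sum_le_card_nsmul _ _ ((((t + b : ℕ) : ℚ≥0) / Fintype.card V) ^ (b * r)) ?_).trans_eq ?_
  · rintro ⟨T, B⟩ hp
    obtain ⟨hT, hB⟩ : #T = t ∧ #B = b := by simpa using hp
    refine (dens_mapsTo_le _ _).trans ?_
    rw [card_product, hB, card_fin, dens]
    gcongr
    exact (card_union_le T B).trans_eq (by rw [hT, hB])
  · simp

end Densities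

end StubMatching

section Estimates

theorem choose_mul_pow_le_exp {x : ℝ} (hx : 0 ≤ x) (n k : ℕ) :
    n.choose k * x ^ k ≤ Real.exp (n * x) := by
  rcases lt_or_ge n k with hnk | hkn
  · simpa [Nat.choose_eq_zero_of_lt hnk] using (Real.exp_pos _).le
  calc n.choose k * x ^ k
      = x ^ k * 1 ^ (n - k) * n.choose k := by rw [one_pow, mul_one, mul_comm]
    _ ≤ ∑ m ∈ range (n + 1), x ^ m * 1 ^ (n - m) * n.choose m :=
        single_le_sum (f := fun m ↦ x ^ m * 1 ^ (n - m) * n.choose m)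
          (fun m _ ↦ by positivity) (mem_range.mpr (by omega))
    _ = (x + 1) ^ n := (add_pow x 1 n).symm
    _ ≤ Real.exp x ^ n := by
        gcongr
        exact Real.add_one_le_exp x
    _ = Real.exp (n * x) := (Real.exp_nat_mul x n).symm

theorem choose_div_hundred_le (n : ℕ) :
    n.choose (n / 100) ≤ Real.exp (6 / 100 * n) := by
  have hbase : (100 : ℝ) ≤ Real.exp 5 := by
    rw [← mul_one (5 : ℝ), show (5 : ℝ) = (5 : ℕ) by norm_num, Real.exp_nat_mul]
    refine le_trans ?_ (pow_le_pow_left₀ (by norm_num) Real.exp_one_gt_d9.le 5)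
    norm_num
  have hfloor : ((n / 100 : ℕ) : ℝ) ≤ n / 100 := Nat.cast_div_le
  calc (n.choose (n / 100) : ℝ)
      = n.choose (n / 100) * (1 / 100) ^ (n / 100) * 100 ^ (n / 100) := by
        rw [mul_assoc, ← mul_pow]
        norm_num
    _ ≤ Real.exp (n * (1 / 100)) * Real.exp 5 ^ (n / 100) := by
        gcongr
        exact choose_mul_pow_le_exp (by norm_num) _ _
    _ ≤ Real.exp (6 / 100 * n) := by
        rw [← Real.exp_nat_mul, ← Real.exp_add, Real.exp_le_exp]
        linarith

/- For `b = n / 10` the binomial coefficient is about `(10 * exp 1) ^ b` at most, which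
`(11 / 100) ^ (2 * b)` beats because `10 * (11 / 100) ^ 2 < exp (-2)`. -/
theorem choose_div_ten_mul_pow_le (n : ℕ) :
    n.choose (n / 10) * (11 / 100 : ℝ) ^ (2 * (n / 10)) ≤ Real.exp (2 - 1 / 10 * n) := by
  have hbase : 10 * (11 / 100 : ℝ) ^ 2 ≤ Real.exp (-2) := by
    rw [Real.exp_neg, le_inv_comm₀ (by norm_num) (Real.exp_pos 2), ← mul_one (2 : ℝ),
      show (2 : ℝ) = (2 : ℕ) by norm_num, Real.exp_nat_mul]
    refine (pow_le_pow_left₀ (Real.exp_pos 1).le Real.exp_one_lt_d9.le 2).trans ?_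
    norm_num
  have hfloor : (n : ℝ) / 10 - 1 ≤ (n / 10 : ℕ) := by
    have : n ≤ 10 * (n / 10) + 10 := by omega
    have : (n : ℝ) ≤ 10 * (n / 10 : ℕ) + 10 := by exact_mod_cast this
    linarith
  calc n.choose (n / 10) * (11 / 100 : ℝ) ^ (2 * (n / 10))
      = n.choose (n / 10) * (1 / 10) ^ (n / 10) * (10 * (11 / 100 : ℝ) ^ 2) ^ (n / 10) := by
        rw [mul_assoc, ← mul_pow, pow_mul]
        norm_num
    _ ≤ Real.exp (n * (1 / 10)) * Real.exp (-2) ^ (n / 10) := by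
        gcongr
        exact choose_mul_pow_le_exp (by norm_num) _ _
    _ ≤ Real.exp (2 - 1 / 10 * n) := by
        rw [← Real.exp_nat_mul, ← Real.exp_add, Real.exp_le_exp]
        linarith

theorem choose_mul_choose_mul_pow_le {r : ℕ} (hr : 2 ≤ r) (n : ℕ) :
    (n.choose (n / 100) * n.choose (n / 10) *
      (((n / 100 + n / 10 : ℕ) : ℝ) / n) ^ (n / 10 * r)) ≤ Real.exp (2 - n / 25) := by
  have hratio : ((n / 100 + n / 10 : ℕ) : ℝ) / n ≤ 11 / 100 := by
    refine div_le_of_le_mul₀ (by positivity) (by norm_num) ?_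
    have h₁ : ((n / 100 : ℕ) : ℝ) ≤ n / 100 := Nat.cast_div_le
    have h₂ : ((n / 10 : ℕ) : ℝ) ≤ n / 10 := Nat.cast_div_le
    push_cast
    linarith
  have hpow : (((n / 100 + n / 10 : ℕ) : ℝ) / n) ^ (n / 10 * r) ≤
      (11 / 100) ^ (2 * (n / 10)) := by
    refine (pow_le_pow_left₀ (by positivity) hratio _).trans
      (pow_le_pow_of_le_one (by norm_num) (by norm_num) ?_)
    rw [mul_comm]
    exact Nat.mul_le_mul_left _ hr
  calc _ ≤ n.choose (n / 100) * (n.choose (n / 10) * (11 / 100 : ℝ) ^ (2 * (n / 10))) := by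
        rw [mul_assoc]
        gcongr
    _ ≤ Real.exp (6 / 100 * n) * Real.exp (2 - 1 / 10 * n) :=
        mul_le_mul (choose_div_hundred_le n) (choose_div_ten_mul_pow_le n) (by positivity)
          (Real.exp_pos _).le
    _ = Real.exp (2 - n / 25) := by
        rw [← Real.exp_add]
        ring_nf

theorem eventually_exp_mul_pow_le_exp (a : ℝ) (k : ℕ) :
    ∀ᶠ n : ℕ in atTop, Real.exp (2 - n / 25) * (2 * (n * a) ^ k) ≤ Real.exp (-(1 / 50 * n)) := by
  have hlim : Tendsto (fun n : ℕ ↦ (n : ℝ) ^ k * Real.exp (-(1 / 50)) ^ n) atTop (nhds 0) :=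
    tendsto_pow_const_mul_const_pow_of_abs_lt_one k <| by
      rw [Real.abs_exp, Real.exp_lt_one_iff]
      norm_num
  have hlim' := hlim.const_mul (2 * Real.exp 2 * a ^ k)
  rw [mul_zero] at hlim'
  filter_upwards [hlim'.eventually_le_const one_pos] with n hn
  calc Real.exp (2 - n / 25) * (2 * (n * a) ^ k)
      = 2 * Real.exp 2 * a ^ k * ((n : ℝ) ^ k * Real.exp (-(1 / 50)) ^ n) *
          Real.exp (-(1 / 50 * n)) := by
        have hexp : Real.exp (2 - (n : ℝ) / 25) =
            Real.exp 2 * Real.exp (-(1 / 50)) ^ n * Real.exp (-(1 / 50 * n)) := by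
          rw [← Real.exp_nat_mul, ← Real.exp_add, ← Real.exp_add]
          ring_nf
        rw [hexp, mul_pow]
        ring
    _ ≤ Real.exp (-(1 / 50 * n)) := mul_le_of_le_one_left (Real.exp_pos _).le hn

end Estimates

section ConfigurationModel

variable {n r : ℕ}

theorem toDigraph_mem_regularOrientedGraphs {π : StubMatching (Fin n) r} (h : π.badStubs = ∅) :
    π.toDigraph ∈ regularOrientedGraphs n r :=
  have hgood (x : Fin n × Fin r) : ¬ π.IsBadStub x :=
    StubMatching.mem_badStubs.not.mp (h ▸ notMem_empty x)
  ⟨StubMatching.isOrientedGraph_toDigraph hgood, StubMatching.isRegularDigraph_toDigraph hgood⟩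

theorem regularOrientedGraphs_nonempty (hr : r ≠ 0) (hn : 16 * r + 2 < n) :
    (regularOrientedGraphs n r).Nonempty := by
  have hdens : dens {π : StubMatching (Fin n) r | π.badStubs = ∅} ≠ 0 := by
    intro h
    have hone := StubMatching.one_le_mul_dens_badStubs_eq_empty hr
      (hn.trans_eq (Fintype.card_fin n).symm)
    rw [h, mul_zero] at hone
    exact absurd hone (by norm_num)
  obtain ⟨π, hπ⟩ := dens_ne_zero.mp hdens
  exact ⟨π.toDigraph, toDigraph_mem_regularOrientedGraphs ((mem_filter_univ π).mp hπ)⟩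

theorem uniformOn_regularOrientedGraphs_real_le (hr : r ≠ 0) (hn : 16 * r + 2 < n) {t b : ℕ}
    (htb : t + b ≤ n) :
    (uniformOn (regularOrientedGraphs n r)).real {D | n ≤ D.acyclicNumber + t} ≤
      n.choose t * n.choose b * (((t + b : ℕ) : ℝ) / n) ^ (b * r) *
        (2 * (n * r) ^ (24 * r ^ 2)) := by
  classical
  rw [uniformOn_real_eq_dens_div_dens (f := StubMatching.toDigraph) (Set.toFinite _)
    (by positivity) fun D hD ↦ StubMatching.card_toDigraph_eq hD.2]
  refine div_le_of_le_mul₀ (by positivity) (by positivity) ?_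
  rw [← Fintype.card_fin n] at hn htb
  have hsimple : (1 : ℝ) ≤ 2 * (n * r) ^ (24 * r ^ 2) *
      dens {π : StubMatching (Fin n) r | π.toDigraph ∈ regularOrientedGraphs n r} := by
    have hsub := dens_le_dens (monotone_filter_right univ
      fun (π : StubMatching (Fin n) r) _ ↦ toDigraph_mem_regularOrientedGraphs (π := π))
    have hle := (StubMatching.one_le_mul_dens_badStubs_eq_empty hr hn).trans
      (mul_le_mul_right hsub _)
    rw [Fintype.card_fin] at hle
    exact_mod_cast hle
  have hlarge : (dens {π : StubMatching (Fin n) r | π.toDigraph ∈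
      regularOrientedGraphs n r ∩ {D | n ≤ D.acyclicNumber + t}} : ℝ) ≤
      n.choose t * n.choose b * (((t + b : ℕ) : ℝ) / n) ^ (b * r) := by
    have hle := StubMatching.dens_le_acyclicNumber_add_le (V := Fin n) (r := r) htb
    rw [Fintype.card_fin] at hle
    refine le_trans ?_ (NNRat.cast_le (K := ℝ).mpr hle) |>.trans_eq (by push_cast; rfl)
    exact NNRat.cast_le.mpr (dens_le_dens (monotone_filter_right univ fun π _ h ↦ h.2))
  rw [mul_assoc]
  exact hlarge.trans (le_mul_of_one_le_right (by positivity) hsimple)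

theorem compl_setOf_acyclicNumber_le_subset :
    {D : Digraph (Fin n) | (D.acyclicNumber : ℝ) ≤ 99 / 100 * n}ᶜ ⊆
      {D | n ≤ D.acyclicNumber + n / 100} := by
  intro D hD
  have hlt : 99 / 100 * (n : ℝ) < D.acyclicNumber := not_le.mp hD
  have : 99 * n < 100 * D.acyclicNumber := by
    rify
    linarith
  exact Nat.le_of_lt_succ (by omega)

end ConfigurationModel

theorem proposition4p2 (r : ℕ) (hr : 2 ≤ r) :
    HoldsWithVeryHighProbability
      (fun n : ℕ => uniformOn (Digraph.regularOrientedGraphs n r))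
      (fun n : ℕ => {D : Digraph (Fin n) | (D.acyclicNumber : ℝ) ≤ 99 / 100 * (n : ℝ)}) := by
  refine ⟨1 / 50, by norm_num, ?_⟩
  filter_upwards [eventually_exp_mul_pow_le_exp r (24 * r ^ 2), eventually_gt_atTop (16 * r + 2)]
    with n hexp hn
  have := isProbabilityMeasure_uniformOn (Set.toFinite (regularOrientedGraphs n r))
    (regularOrientedGraphs_nonempty (by omega) hn)
  rw [sub_le_comm, ← probReal_compl_eq_one_sub (Set.toFinite _).measurableSet]
  calc (uniformOn (regularOrientedGraphs n r)).real
        {D : Digraph (Fin n) | (D.acyclicNumber : ℝ) ≤ 99 / 100 * n}ᶜ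
      ≤ (uniformOn (regularOrientedGraphs n r)).real {D | n ≤ D.acyclicNumber + n / 100} :=
        measureReal_mono compl_setOf_acyclicNumber_le_subset
    _ ≤ _ := uniformOn_regularOrientedGraphs_real_le (by omega) hn (b := n / 10) (by omega)
    _ ≤ Real.exp (2 - n / 25) * (2 * (n * r) ^ (24 * r ^ 2)) := by
        gcongr
        exact choose_mul_choose_mul_pow_le hr n
    _ ≤ Real.exp (-(1 / 50 * n)) := hexp
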